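/- **Graphs.** A graph is a finite simple undirected graph on nodes $1,\dots,n$ with adjacency matrix $A$, degree matrix $D$ and node features $X_i\in\mathbb R^p$. A multi-layer perceptron (MLP) has any number of hidden layers of any widths. $\mathrm{Pool}$ is the sum, the mean or the maximum over the nodes. $\Vert$ denotes concatenation, $\odot$ the entrywise product, and $\mathrm{diagonal}(S)$ the vector of diagonal entries of $S$. **Point Set Transformer (PST) with $k$ layers.** Let $Z$ be one of the symmetric matrices $A$, $D-A$, $D+A$, $D^{-1/2}AD^{-1/2}$, let $\Lambda\in\mathbb R^r$ be its non-zero eigenvalues and $U\in\mathbb R^{n\times r}$ corresponding orthonormal eigenvectors. The coordinate $v_i\in\mathbb R^{r\times d}$ of node $i$ has in channel $c$ the $i$-th row of $U\,\mathrm{diag}(f_c(\Lambda))$, where $f(\Lambda)_l=\mathrm{MLP}(\Lambda_l\Vert\sum_m\mathrm{MLP}'(\Lambda_m))\in\mathbb R^d$. The scalars $s_i\in\mathbb R^d$ start as a linear embedding of $X_i$. Each layer computes, with learnable matrices $W$ and ReLU MLPs, $$s_i'=\mathrm{MLP}_1(s_i\Vert\mathrm{diagonal}(W_1v_i^Tv_iW_2^T)),\qquad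 v_i'=v_i\,\mathrm{diag}(\mathrm{MLP}_2(s_i))W_3+v_iW_4,$$ $$a_{ij}=\mathrm{MLP}_3\big((W_q^ss_i'\odot W_k^ss_j')\Vert\mathrm{diagonal}(W_q^vv_i'^Tv_j'W_k^v)\big)\in\mathbb R,$$ $$s_i\leftarrow\mathrm{MLP}_4\big(s_i'\Vert\textstyle\sum_ja_{ij}s_j'\big),\qquad v_i\leftarrow\big(v_i'\Vert\textstyle\sum_ja_{ij}v_j'\big)W_5 .$$ The output is $\mathrm{Pool}$ of the final $s_i$. **Graphormer with $k$ layers.** Start from $h_i=WX_i+z_{\deg(i)}$ with a learnable table $z$. Each layer is $h'=\mathrm{MHA}(\mathrm{LN}(h))+h$, $h\leftarrow\mathrm{MLP}(\mathrm{LN}(h'))+h'$, where LN is layer normalization and MHA is multi-head softmax attention whose scores are the scaled inner products of queries and keys plus, for each head, a learnable bias $b_{\mathrm{spd}(i,j)}$ depending on the shortest path distance (including $\infty$), shared by the layers. The output is either $\mathrm{Pool}$ of the final $h_i$, or the final representation of an additional virtual node, with a learnable initial feature, which takes part in the attention; every pair containing it has one learnable bias for each head. **GPS with $k$ layers and RWSE.**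 Start from $h_i=\mathrm{MLP}(X_i\Vert\mathrm{RWSE}_i)$, where $\mathrm{RWSE}_i=\big(((D^{-1}A)^t)_{ii}\big)_{t=1}^m$ and $m$ is arbitrary. Each layer is $g_i=\mathrm{BN}(h_i+\mathrm{MPNN}(h)_i)+\mathrm{BN}(h_i+\mathrm{MHA}(h)_i)$, $h_i\leftarrow\mathrm{BN}(g_i+\mathrm{MLP}(g_i))$, where $\mathrm{MPNN}(h)_i$ is an arbitrary function of $h_i$ and of the multiset of the $h_j$ with $j$ adjacent to $i$, MHA is multi-head softmax attention over all nodes without bias, and BN is batch normalization with fixed statistics (an affine map of each channel). The output is $\mathrm{Pool}$ of the final $h_i$. In all three families the hidden dimension, the numbers of heads and all weights are arbitrary; in Graphormer and GPS the activation function $\mathbb R\to\mathbb R$ is arbitrary too. In $D^{-1}$ and $D^{-1/2}$ the entry of an isolated node is $0$. **Expressivity.** A family differentiates two graphs with the same feature dimension if some network of the family gives them different outputs. A family is more expressive than a second one if it differentiates every pair of graphs that the second one differentiates, and strictly more expressive if moreover it differentiates some pair that the second one does not. **Theorem.** Let $k\ge1$. The $k$-layer Point Set Transformers are strictly more expressive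 than the $k$-layer Graphormers, and strictly more expressive than the $k$-layer GPS networks with RWSE. The first comparison already holds for the Point Set Transformers with $Z=D-A$, the second for those with $Z=D^{-1/2}AD^{-1/2}$. -/

import Mathlib

open Matrix

noncomputable section

namespace PointSet

/-- An undirected simple graph on `n` nodes, with a feature vector in `ℝ^p` at every node. -/
structure FeaturedGraph (p : ℕ) where
  n : ℕ
  graph : SimpleGraph (Fin n)
  X : Fin n → Fin p → ℝ

/-- The parameters of a multi-layer perceptron `ℝ^a → ℝ^b`: any number of hidden layers, of any
widths. -/
inductive MLP : ℕ → ℕ → Type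
  | output {a b : ℕ} (W : Matrix (Fin b) (Fin a) ℝ) (β : Fin b → ℝ) : MLP a b
  | hidden {a h b : ℕ} (W : Matrix (Fin h) (Fin a) ℝ) (β : Fin h → ℝ) (rest : MLP h b) : MLP a b

/-- The function computed by a perceptron whose hidden units have the activation `σ`. -/
def MLP.eval (σ : ℝ → ℝ) : {a b : ℕ} → MLP a b → (Fin a → ℝ) → (Fin b → ℝ)
  | _, _, .output W β, x => W *ᵥ x + β
  | _, _, .hidden W β rest, x => rest.eval σ (fun i => σ ((W *ᵥ x + β) i))

def relu (x : ℝ) : ℝ := max x 0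

/-- Permutation-invariant pooling of the node representations, channel by channel. -/
inductive Pool
  | sum
  | mean
  | max

def Pool.apply {n d : ℕ} : Pool → (Fin n → Fin d → ℝ) → (Fin d → ℝ)
  | .sum, s => fun c => ∑ i, s i c
  | .mean, s => fun c => (∑ i, s i c) / n
  | .max, s => fun c => ⨆ i, s i c

section Matrices

open scoped Classical in
/-- The adjacency matrix `A`. -/
def adjM {n : ℕ} (G : SimpleGraph (Fin n)) : Matrix (Fin n) (Fin n) ℝ := G.adjMatrix ℝ

open scoped Classical in
/-- The degree of a node, as a natural number. -/
def deg {n : ℕ} (G : SimpleGraph (Fin n)) (i : Fin n) : ℕ := G.degree i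

/-- The degree matrix `D`. -/
def degM {n : ℕ} (G : SimpleGraph (Fin n)) : Matrix (Fin n) (Fin n) ℝ :=
  Matrix.diagonal fun i => (deg G i : ℝ)

/-- The normalized adjacency matrix `D^{-1/2} A D^{-1/2}` (isolated nodes have zero rows). -/
def normAdjM {n : ℕ} (G : SimpleGraph (Fin n)) : Matrix (Fin n) (Fin n) ℝ :=
  Matrix.of fun i j => adjM G i j / (√(deg G i) * √(deg G j))

/-- The random walk matrix `D⁻¹ A` (isolated nodes have zero rows). -/
def walkM {n : ℕ} (G : SimpleGraph (Fin n)) : Matrix (Fin n) (Fin n) ℝ :=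
  Matrix.of fun i j => adjM G i j / deg G i

/-- The symmetric matrices of a graph from which point coordinates are produced: `A`, `D - A`,
`D + A` and `D^{-1/2} A D^{-1/2}`. -/
inductive AdjacencyFunction
  | adjacency
  | laplacian
  | augmentedAdjacency
  | normalizedAdjacency

def AdjacencyFunction.toMatrix (Z : AdjacencyFunction) {n : ℕ} (G : SimpleGraph (Fin n)) :
    Matrix (Fin n) (Fin n) ℝ :=
  match Z with
  | .adjacency => adjM G
  | .laplacian => degM G - adjM G
  | .augmentedAdjacency => degM G + adjM G
  | .normalizedAdjacency => normAdjM G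

theorem adjM_isHermitian {n : ℕ} (G : SimpleGraph (Fin n)) : (adjM G).IsHermitian := by
  classical
  ext i j
  simp [adjM, SimpleGraph.adjMatrix_apply, G.adj_comm]

theorem degM_isHermitian {n : ℕ} (G : SimpleGraph (Fin n)) : (degM G).IsHermitian := by
  ext i j
  by_cases h : i = j
  · subst h; simp [degM]
  · simp [degM, h, Ne.symm h]

theorem AdjacencyFunction.isHermitian (Z : AdjacencyFunction) {n : ℕ} (G : SimpleGraph (Fin n)) :
    (Z.toMatrix G).IsHermitian := by
  cases Z with
  | adjacency => exact adjM_isHermitian G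
  | laplacian => exact (degM_isHermitian G).sub (adjM_isHermitian G)
  | augmentedAdjacency => exact (degM_isHermitian G).add (adjM_isHermitian G)
  | normalizedAdjacency =>
    ext i j
    have h := (adjM_isHermitian G).apply i j
    simp only [star_trivial] at h
    simp [AdjacencyFunction.toMatrix, normAdjM, h, mul_comm]

end Matrices

section PST

/-- A permutation-equivariant eigenvalue function with `d` channels, in DeepSet form:
`f(Λ)_l = outer (Λ_l ‖ ∑_m inner Λ_m)`. -/
structure EigenvalueFunction (d : ℕ) where
  width : ℕ
  inner : MLP 1 width
  outer : MLP (1 + width) d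

def EigenvalueFunction.eval {d : ℕ} (f : EigenvalueFunction d) {ρ : Type} [Fintype ρ]
    (Λ : ρ → ℝ) (l : ρ) : Fin d → ℝ :=
  f.outer.eval relu
    (Fin.append (fun _ : Fin 1 => Λ l) (∑ m, f.inner.eval relu (fun _ => Λ m)))

/-- The index set of the non-zero eigenvalues of `Z`, with multiplicity; its size is the rank. -/
abbrev SpectralIndex (Z : AdjacencyFunction) {n : ℕ} (G : SimpleGraph (Fin n)) : Type :=
  {l : Fin n // (Z.isHermitian G).eigenvalues l ≠ 0}

open scoped Classical in
/-- Parameterized symmetric rank decomposition: channel `c` of the coordinates is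
`U diag(f_c(Λ))`, with `Λ` the non-zero eigenvalues of the matrix `Z` and `U` the matrix of
corresponding orthonormal eigenvectors. The coordinate of node `i` is an `r × d` matrix.
Another choice of eigenvectors changes all coordinates by one common orthogonal transformation of
`ℝ^r`, under which the output of a Point Set Transformer is invariant. -/
def psrd (Z : AdjacencyFunction) {d : ℕ} (f : EigenvalueFunction d) {n : ℕ}
    (G : SimpleGraph (Fin n)) (i : Fin n) : Matrix (SpectralIndex Z G) (Fin d) ℝ :=
  Matrix.of fun l c =>
    ((Z.isHermitian G).eigenvectorUnitary : Matrix (Fin n) (Fin n) ℝ) i l *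
      f.eval (fun m : SpectralIndex Z G => (Z.isHermitian G).eigenvalues m) l c

/-- The parameters of one layer: a scalar-vector mixer followed by an attention layer. -/
structure PSTLayer (d : ℕ) where
  mlp₁ : MLP (d + d) d
  mlp₂ : MLP d d
  W₁ : Matrix (Fin d) (Fin d) ℝ
  W₂ : Matrix (Fin d) (Fin d) ℝ
  W₃ : Matrix (Fin d) (Fin d) ℝ
  W₄ : Matrix (Fin d) (Fin d) ℝ
  Wqs : Matrix (Fin d) (Fin d) ℝ
  Wks : Matrix (Fin d) (Fin d) ℝ
  Wqv : Matrix (Fin d) (Fin d) ℝ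
  Wkv : Matrix (Fin d) (Fin d) ℝ
  mlp₃ : MLP (d + d) 1
  mlp₄ : MLP (d + d) d
  W₅ : Matrix (Fin d ⊕ Fin d) (Fin d) ℝ

/-- The representations of `n` points: scalars `s i ∈ ℝ^d` and vectors `v i ∈ ℝ^{r × d}`. -/
structure PointState (n d : ℕ) (ρ : Type) where
  s : Fin n → Fin d → ℝ
  v : Fin n → Matrix ρ (Fin d) ℝ

variable {n d : ℕ} {ρ : Type} [Fintype ρ]

/-- The scalar-vector mixer. -/
def PSTLayer.mix (L : PSTLayer d) (x : PointState n d ρ) : PointState n d ρ where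
  s i := L.mlp₁.eval relu (Fin.append (x.s i) (L.W₁ * (x.v i)ᵀ * x.v i * L.W₂ᵀ).diag)
  v i := x.v i * Matrix.diagonal (L.mlp₂.eval relu (x.s i)) * L.W₃ + x.v i * L.W₄

/-- The attention score of the pair `(i, j)`. -/
def PSTLayer.atten (L : PSTLayer d) (x : PointState n d ρ) (i j : Fin n) : ℝ :=
  L.mlp₃.eval relu
    (Fin.append ((L.Wqs *ᵥ x.s i) * (L.Wks *ᵥ x.s j)) (L.Wqv * (x.v i)ᵀ * x.v j * L.Wkv).diag) 0

/-- The attention layer. -/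
def PSTLayer.attend (L : PSTLayer d) (x : PointState n d ρ) : PointState n d ρ where
  s i := L.mlp₄.eval relu (Fin.append (x.s i) (∑ j, L.atten x i j • x.s j))
  v i := Matrix.fromCols (x.v i) (∑ j, L.atten x i j • x.v j) * L.W₅

def PSTLayer.apply (L : PSTLayer d) (x : PointState n d ρ) : PointState n d ρ :=
  L.attend (L.mix x)

/-- A Point Set Transformer with `k` layers for graphs with `p` node features: hidden dimension
`d`, a linear embedding of the node features, an eigenvalue function, the layers, a pooling. -/
structure PST (p k : ℕ) where
  d : ℕ
  embed : Matrix (Fin d) (Fin p) ℝ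
  f : EigenvalueFunction d
  layers : Fin k → PSTLayer d
  pool : Pool

open scoped Classical in
/-- The graph representation, with coordinates produced from the matrix `Z`. -/
def PST.out {p k : ℕ} (P : PST p k) (Z : AdjacencyFunction) (G : FeaturedGraph p) :
    Fin P.d → ℝ :=
  let x₀ : PointState G.n P.d (SpectralIndex Z G.graph) :=
    { s := fun i => P.embed *ᵥ G.X i
      v := psrd Z P.f G.graph }
  P.pool.apply ((List.ofFn P.layers).foldl (fun x L => L.apply x) x₀).s

end PST

section Attention

/-- The matrices of a softmax attention with `H` heads of dimension `e`. -/
structure MultiHead (d H : ℕ) where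
  e : ℕ
  WQ : Fin H → Matrix (Fin e) (Fin d) ℝ
  WK : Fin H → Matrix (Fin e) (Fin d) ℝ
  WV : Fin H → Matrix (Fin e) (Fin d) ℝ
  WO : Matrix (Fin d) (Fin H × Fin e) ℝ

variable {d H : ℕ} {τ : Type} [Fintype τ]

def MultiHead.score (M : MultiHead d H) (bias : Fin H → τ → τ → ℝ) (h : τ → Fin d → ℝ)
    (a : Fin H) (i j : τ) : ℝ :=
  ((M.WQ a *ᵥ h i) ⬝ᵥ (M.WK a *ᵥ h j)) / √(M.e) + bias a i j

def MultiHead.weight (M : MultiHead d H) (bias : Fin H → τ → τ → ℝ) (h : τ → Fin d → ℝ)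
    (a : Fin H) (i j : τ) : ℝ :=
  Real.exp (M.score bias h a i j) / ∑ l, Real.exp (M.score bias h a i l)

/-- Multi-head softmax self-attention over the tokens `τ`, with an additive bias on the scores. -/
def MultiHead.apply (M : MultiHead d H) (bias : Fin H → τ → τ → ℝ) (h : τ → Fin d → ℝ)
    (i : τ) : Fin d → ℝ :=
  M.WO *ᵥ fun ac => ∑ j, M.weight bias h ac.1 i j * (M.WV ac.1 *ᵥ h j) ac.2

end Attention

section Graphormer

structure LayerNorm (d : ℕ) where
  γ : Fin d → ℝ
  β : Fin d → ℝ
  ε : ℝ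

def LayerNorm.apply {d : ℕ} (N : LayerNorm d) (x : Fin d → ℝ) : Fin d → ℝ :=
  let μ : ℝ := (∑ c, x c) / d
  let var : ℝ := (∑ c, (x c - μ) ^ 2) / d
  fun c => N.γ c * ((x c - μ) / √(var + N.ε)) + N.β c

structure GraphormerLayer (d H : ℕ) where
  ln₁ : LayerNorm d
  mha : MultiHead d H
  ln₂ : LayerNorm d
  ffn : MLP d d

/-- `h' = MHA(LN(h)) + h`, then `FFN(LN(h')) + h'`. -/
def GraphormerLayer.apply {d H : ℕ} (L : GraphormerLayer d H) (σ : ℝ → ℝ) {τ : Type} [Fintype τ]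
    (bias : Fin H → τ → τ → ℝ) (h : τ → Fin d → ℝ) : τ → Fin d → ℝ :=
  let h' : τ → Fin d → ℝ := fun i => L.mha.apply bias (fun j => L.ln₁.apply (h j)) i + h i
  fun i => L.ffn.eval σ (L.ln₂.apply (h' i)) + h' i

/-- The graph representation is read off an additional virtual node, or it is pooled from the nodes
(then there is no virtual node). -/
inductive GraphormerReadout
  | virtualNode
  | pool (q : Pool)

/-- A Graphormer with `k` layers: activation `σ`, linear embedding of the node features, centrality
encoding `z` indexed by the degree, spatial encoding `b` (for each head) indexed by the shortest
path distance (`⊤` if there is no path), initial feature `hv` of the virtual node and spatial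
encoding `t` of the pairs that contain it. -/
structure Graphormer (p k : ℕ) where
  σ : ℝ → ℝ
  d : ℕ
  H : ℕ
  embed : Matrix (Fin d) (Fin p) ℝ
  z : ℕ → Fin d → ℝ
  b : Fin H → ℕ∞ → ℝ
  hv : Fin d → ℝ
  t : Fin H → ℝ
  layers : Fin k → GraphormerLayer d H
  readout : GraphormerReadout

def Graphormer.init {p k : ℕ} (P : Graphormer p k) (G : FeaturedGraph p) (i : Fin G.n) :
    Fin P.d → ℝ :=
  P.embed *ᵥ G.X i + P.z (deg G.graph i)

def Graphormer.encode {p k : ℕ} (P : Graphormer p k) {τ : Type} [Fintype τ]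
    (bias : Fin P.H → τ → τ → ℝ) (h₀ : τ → Fin P.d → ℝ) : τ → Fin P.d → ℝ :=
  (List.ofFn P.layers).foldl (fun h L => L.apply P.σ bias h) h₀

def Graphormer.out {p k : ℕ} (P : Graphormer p k) (G : FeaturedGraph p) : Fin P.d → ℝ :=
  match P.readout with
  | .pool q => q.apply (P.encode (fun a i j => P.b a (G.graph.edist i j)) (P.init G))
  | .virtualNode =>
    P.encode (τ := Option (Fin G.n))
      (fun a x y =>
        match x, y with
        | some i, some j => P.b a (G.graph.edist i j)
        | _, _ => P.t a)
      (fun x =>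
        match x with
        | some i => P.init G i
        | none => P.hv)
      none

end Graphormer

section GPS

/-- Random walk structural encoding with `m` steps: the probabilities that a random walk from `i`
is at `i` after `1, …, m` steps. -/
def rwse {n : ℕ} (G : SimpleGraph (Fin n)) (m : ℕ) (i : Fin n) : Fin m → ℝ :=
  fun t => ((walkM G) ^ (t.1 + 1)) i i

/-- Batch normalization with fixed statistics, an affine map on each channel. -/
structure BatchNorm (d : ℕ) where
  γ : Fin d → ℝ
  β : Fin d → ℝ

def BatchNorm.apply {d : ℕ} (N : BatchNorm d) (x : Fin d → ℝ) : Fin d → ℝ := N.γ * x + N.β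

/-- `mpnn` is an arbitrary message passing layer: the new feature of a node is any function of its
feature and of the multiset of the features of its neighbours. -/
structure GPSLayer (d H : ℕ) where
  mpnn : (Fin d → ℝ) → Multiset (Fin d → ℝ) → (Fin d → ℝ)
  mha : MultiHead d H
  bnM : BatchNorm d
  bnT : BatchNorm d
  mlp : MLP d d
  bnO : BatchNorm d

open scoped Classical in
/-- A local message passing block and a global attention block in parallel, each with a residual
connection and normalization, summed and passed to a perceptron. -/
def GPSLayer.apply {d H : ℕ} (L : GPSLayer d H) (σ : ℝ → ℝ) {n : ℕ} (G : SimpleGraph (Fin n))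
    (h : Fin n → Fin d → ℝ) : Fin n → Fin d → ℝ :=
  let hM : Fin n → Fin d → ℝ := fun i =>
    L.bnM.apply (h i + L.mpnn (h i) ((G.neighborFinset i).val.map h))
  let hT : Fin n → Fin d → ℝ := fun i => L.bnT.apply (h i + L.mha.apply (fun _ _ _ => 0) h i)
  fun i => L.bnO.apply ((hM i + hT i) + L.mlp.eval σ (hM i + hT i))

/-- A GPS network with `k` layers and random walk structural encoding of `m` steps, which is joined
to the node features before the first layer. -/
structure GPS (p k : ℕ) where
  σ : ℝ → ℝ
  d : ℕ
  H : ℕ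
  m : ℕ
  encoder : MLP (p + m) d
  layers : Fin k → GPSLayer d H
  pool : Pool

def GPS.out {p k : ℕ} (P : GPS p k) (G : FeaturedGraph p) : Fin P.d → ℝ :=
  P.pool.apply
    ((List.ofFn P.layers).foldl (fun h L => L.apply P.σ G.graph h)
      (fun i => P.encoder.eval P.σ (Fin.append (G.X i) (rwse G.graph P.m i))))

end GPS

section Expressivity

/-- A family of networks, recorded through the pairs of graphs that some network of the family
differentiates. -/
abbrev Algorithm : Type := ∀ p : ℕ, FeaturedGraph p → FeaturedGraph p → Prop

/-- The `k`-layer Point Set Transformers with coordinates from `Z`. -/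
def pstWith (Z : AdjacencyFunction) (k : ℕ) : Algorithm :=
  fun p G H => ∃ P : PST p k, P.out Z G ≠ P.out Z H

/-- The `k`-layer Point Set Transformers. -/
def pst (k : ℕ) : Algorithm :=
  fun p G H => ∃ Z : AdjacencyFunction, pstWith Z k p G H

def graphormer (k : ℕ) : Algorithm :=
  fun p G H => ∃ P : Graphormer p k, P.out G ≠ P.out H

def gps (k : ℕ) : Algorithm :=
  fun p G H => ∃ P : GPS p k, P.out G ≠ P.out H

def MoreExpressive (𝒜 ℬ : Algorithm) : Prop :=
  ∀ (p : ℕ) (G H : FeaturedGraph p), ℬ p G H → 𝒜 p G H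

def StrictlyMoreExpressive (𝒜 ℬ : Algorithm) : Prop :=
  MoreExpressive 𝒜 ℬ ∧ ∃ (p : ℕ) (G H : FeaturedGraph p), 𝒜 p G H ∧ ¬ ℬ p G H

end Expressivity

end PointSet

end

namespace PointSet

theorem exists_relu_sum_eq {b : ℕ} (g : ℝ → Fin b → ℝ) (S : Finset ℝ) :
    ∃ (h : ℕ) (t : Fin h → ℝ) (C : Fin h → Fin b → ℝ) (β : Fin b → ℝ),
      ∀ x ∈ S, (∑ i, relu (x - t i) • C i) + β = g x := by
  induction S using Finset.induction_on_max with
  | empty => exact ⟨0, Fin.elim0, Fin.elim0, 0, by simp⟩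
  | insert a S hS ih =>
    obtain ⟨h, t, C, β, hx⟩ := ih
    obtain ⟨τ, hτ, hSτ⟩ : ∃ τ < a, ∀ x ∈ S, x ≤ τ := by
      rcases S.eq_empty_or_nonempty with rfl | hne
      · exact ⟨a - 1, by linarith, by simp⟩
      · exact ⟨S.max' hne, hS _ (S.max'_mem hne), fun x hx => S.le_max' x hx⟩
    refine ⟨h + 1, Fin.cons τ t,
      Fin.cons ((a - τ)⁻¹ • (g a - ((∑ i, relu (a - t i) • C i) + β))) C, β, fun x hxS => ?_⟩
    rw [Fin.sum_univ_succ]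
    simp only [Fin.cons_zero, Fin.cons_succ]
    rcases Finset.mem_insert.1 hxS with rfl | hxS
    · have h1 : relu (x - τ) = x - τ := max_eq_left (by linarith)
      rw [h1, smul_smul, mul_inv_cancel₀ (by linarith), one_smul]
      abel
    · have h1 : relu (x - τ) = 0 := max_eq_right (by linarith [hSτ x hxS])
      rw [h1, zero_smul, zero_add, hx x hxS]

/-- A ReLU perceptron with one hidden layer interpolates any function on finitely many points. -/
theorem exists_mlp_eval_eq {T : Type*} [Finite T] {a b : ℕ} (p : T → Fin a → ℝ)
    (q : T → Fin b → ℝ) (hpq : ∀ t t', p t = p t' → q t = q t') :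
    ∃ M : MLP a b, ∀ t, M.eval relu (p t) = q t := by
  classical
  have := Fintype.ofFinite T
  obtain ⟨f, hf⟩ := Module.exists_dual_forall_apply_ne_zero (K := ℝ)
    (fun tt : {tt : T × T // p tt.1 ≠ p tt.2} => p tt.1.1 - p tt.1.2)
    (fun tt => sub_ne_zero.2 tt.2)
  have hinj : ∀ t t', f (p t) = f (p t') → p t = p t' := by
    intro t t' h
    by_contra hne
    exact hf ⟨(t, t'), hne⟩ (by simp [h])
  have hg : ∃ g : ℝ → Fin b → ℝ, ∀ t, g (f (p t)) = q t := by
    refine ⟨fun x => if h : ∃ t, f (p t) = x then q h.choose else 0, fun t => ?_⟩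
    have h : ∃ t', f (p t') = f (p t) := ⟨t, rfl⟩
    simp only [h, dite_true]
    exact hpq _ _ (hinj _ _ h.choose_spec)
  obtain ⟨g, hg⟩ := hg
  obtain ⟨h, t, C, β, hx⟩ := exists_relu_sum_eq g (Finset.univ.image fun t => f (p t))
  refine ⟨.hidden (Matrix.of fun _ c => f (Pi.single c 1)) (fun i => - t i)
    (.output (Matrix.of fun c i => C i c) β), fun u => ?_⟩
  have hW : ∀ x : Fin a → ℝ, ∑ c, x c * f (Pi.single c 1) = f x := by
    intro x
    rw [LinearMap.pi_apply_eq_sum_univ f x]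
    refine Finset.sum_congr rfl fun c _ => ?_
    rw [smul_eq_mul]
    congr 2
    ext j
    simp [Pi.single_apply, eq_comm]
  rw [← hg u, ← hx _ (Finset.mem_image_of_mem _ (Finset.mem_univ u))]
  ext c
  simp [MLP.eval, Matrix.mulVec, dotProduct, mul_comm, sub_eq_add_neg]
  simp only [hW]

theorem exists_code {T E : Type*} [Fintype T] {d : ℕ} (hd : Fintype.card T ≤ d) (p : T → E) :
    ∃ code : T → Fin d, ∀ t t', code t = code t' ↔ p t = p t' := by
  classical
  obtain ⟨e⟩ := Function.Embedding.nonempty_of_card_le (α := T) (β := Fin d) (by simpa using hd)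
  refine ⟨fun t => e (Function.surjInv Set.rangeFactorization_surjective
    (Set.rangeFactorization p t)), fun t t' => ?_⟩
  rw [e.injective.eq_iff, (Function.injective_surjInv _).eq_iff]
  exact Subtype.ext_iff

/-- Finitely many points can be classified by a perceptron with one-hot outputs. -/
theorem exists_mlp_eval_eq_single {T : Type*} [Fintype T] {a d : ℕ} (hd : Fintype.card T ≤ d)
    (p : T → Fin a → ℝ) :
    ∃ (M : MLP a d) (code : T → Fin d), (∀ t, M.eval relu (p t) = Pi.single (code t) 1) ∧
      ∀ t t', code t = code t' ↔ p t = p t' := by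
  obtain ⟨code, hcode⟩ := exists_code hd p
  obtain ⟨M, hM⟩ := exists_mlp_eval_eq p (fun t => (Pi.single (code t) 1 : Fin d → ℝ))
    (fun t t' h => by rw [(hcode t t').2 h])
  exact ⟨M, code, hM, hcode⟩

theorem exists_equiv_of_card_filter_eq {ι κ γ : Type*} [Fintype ι] [Fintype κ] [DecidableEq γ]
    (f : ι → γ) (g : κ → γ)
    (h : ∀ c, (Finset.univ.filter fun i => f i = c).card
      = (Finset.univ.filter fun j => g j = c).card) :
    ∃ π : ι ≃ κ, ∀ i, f i = g (π i) := by
  have e : ∀ c, {i // f i = c} ≃ {j // g j = c} := fun c =>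
    Fintype.equivOfCardEq (by simpa [Fintype.card_subtype] using h c)
  exact ⟨Equiv.ofFiberEquiv e, fun i => (Equiv.ofFiberEquiv_map e i).symm⟩

theorem exists_transcendental : ∃ B : ℝ, Transcendental ℤ B :=
  ⟨_, transcendental_liouvilleNumber (m := 2) le_rfl⟩

/-- Sums of powers of a transcendental number determine how often every exponent occurs. -/
theorem card_filter_eq_of_sum_pow_eq {ι κ : Type} [Fintype ι] [Fintype κ] {d : ℕ} {B : ℝ}
    (hB : Transcendental ℤ B) (u : ι → Fin d) (e : ι → ℕ) (u' : κ → Fin d) (e' : κ → ℕ)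
    (h : ∑ i, B ^ e i • (Pi.single (u i) 1 : Fin d → ℝ)
      = ∑ j, B ^ e' j • (Pi.single (u' j) 1 : Fin d → ℝ)) (c : Fin d × ℕ) :
    (Finset.univ.filter fun i => (u i, e i) = c).card
      = (Finset.univ.filter fun j => (u' j, e' j) = c).card := by
  classical
  have key : ∀ {τ : Type} [Fintype τ] (u : τ → Fin d) (e : τ → ℕ),
      (∑ i, B ^ e i • (Pi.single (u i) 1 : Fin d → ℝ)) c.1
        = Polynomial.aeval B
          (∑ i, if u i = c.1 then (Polynomial.X : Polynomial ℤ) ^ e i else 0) := by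
    intro τ _ u e
    rw [Finset.sum_apply, map_sum]
    refine Finset.sum_congr rfl fun i _ => ?_
    by_cases hi : u i = c.1
    · simp [hi]
    · simp [hi, Ne.symm hi]
  have key' : ∀ {τ : Type} [Fintype τ] (u : τ → Fin d) (e : τ → ℕ),
      (∑ i, if u i = c.1 then (Polynomial.X : Polynomial ℤ) ^ e i else 0).coeff c.2
        = ((Finset.univ.filter fun i => (u i, e i) = c).card : ℤ) := by
    intro τ _ u e
    rw [Polynomial.finsetSum_coeff, Finset.card_filter]
    push_cast
    refine Finset.sum_congr rfl fun i _ => ?_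
    by_cases hi : u i = c.1
    · simp [hi, Polynomial.coeff_X_pow, Prod.ext_iff, eq_comm]
    · simp [hi, Prod.ext_iff]
  have h2 := congrFun h c.1
  rw [key, key] at h2
  have h3 := transcendental_iff_injective.1 hB h2
  exact_mod_cast (key' u e).symm.trans ((congrArg (fun P => P.coeff c.2) h3).trans (key' u' e'))

/-- `k` rounds of colour refinement between two node sets: `R` compares nodes, and `T` compares
ordered pairs of nodes. -/
def Similar {ι κ : Type} (R : ι → κ → Prop) (T : ι → ι → κ → κ → Prop) : ℕ → ι → κ → Prop
  | 0 => R
  | t + 1 => fun i j => Similar R T t i j ∧ ∃ π : ι ≃ κ, ∀ m, Similar R T t m (π m) ∧ T i m j (π m)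

theorem Similar.mono {ι κ : Type} {R R' : ι → κ → Prop} {T T' : ι → ι → κ → κ → Prop}
    (hR : ∀ i j, R i j → R' i j) (hT : ∀ i m j m', T i m j m' → T' i m j m') {t : ℕ} {i : ι}
    {j : κ} (h : Similar R T t i j) : Similar R' T' t i j := by
  induction t generalizing i j with
  | zero => exact hR _ _ h
  | succ t ih =>
    obtain ⟨h1, π, hπ⟩ := h
    exact ⟨ih h1, π, fun m => ⟨ih (hπ m).1, hT _ _ _ _ (hπ m).2⟩⟩

theorem Similar.rel {ι κ : Type} {R : ι → κ → Prop} {T : ι → ι → κ → κ → Prop} {t : ℕ} {i : ι}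
    {j : κ} (h : Similar R T t i j) : R i j := by
  induction t with
  | zero => exact h
  | succ t ih => exact ih h.1

theorem Similar.of_le {ι κ : Type} {R : ι → κ → Prop} {T : ι → ι → κ → κ → Prop} {s t : ℕ}
    (hst : s ≤ t) {i : ι} {j : κ} (h : Similar R T t i j) : Similar R T s i j := by
  induction t with
  | zero => rwa [Nat.le_zero.1 hst]
  | succ t ih =>
    rcases Nat.le_succ_iff.1 hst with h' | rfl
    · exact ih h' h.1
    · exact h

/-- Two node sets whose nodes can be matched after `k` rounds of colour refinement. -/
def SimilarSets {ι κ : Type} (R : ι → κ → Prop) (T : ι → ι → κ → κ → Prop) (k : ℕ) : Prop :=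
  ∃ π : ι ≃ κ, ∀ m, Similar R T k m (π m)

theorem SimilarSets.mono {ι κ : Type} {R R' : ι → κ → Prop} {T T' : ι → ι → κ → κ → Prop}
    (hR : ∀ i j, R i j → R' i j) (hT : ∀ i m j m', T i m j m' → T' i m j m') {k : ℕ}
    (h : SimilarSets R T k) : SimilarSets R' T' k :=
  let ⟨π, hπ⟩ := h
  ⟨π, fun m => (hπ m).mono hR hT⟩

/-- The channelwise inner products of the coordinates of two points. -/
def gram {n d : ℕ} {ρ : Type} [Fintype ρ] (v : Fin n → Matrix ρ (Fin d) ℝ) (i j : Fin n) :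
    Fin d → ℝ :=
  ((v i)ᵀ * v j).diag

theorem append_eq_append_iff {a b : ℕ} {x x' : Fin a → ℝ} {y y' : Fin b → ℝ} :
    Fin.append x y = Fin.append x' y' ↔ x = x' ∧ y = y' := by
  refine ⟨fun h => ⟨funext fun i => ?_, funext fun i => ?_⟩, fun h => by rw [h.1, h.2]⟩
  · simpa using congrFun h (Fin.castAdd b i)
  · simpa using congrFun h (Fin.natAdd a i)

section Layer

variable {d n₁ n₂ : ℕ} {ρ₁ ρ₂ : Type} [Fintype ρ₁] [Fintype ρ₂]

/-- The layer that keeps the coordinates, and whose attention depends on the inner products of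
coordinates only. -/
def gramLayer (M₁ : MLP (d + d) d) (M₃ : MLP (d + d) 1) (M₄ : MLP (d + d) d) : PSTLayer d where
  mlp₁ := M₁
  mlp₂ := .output 0 0
  W₁ := 1
  W₂ := 1
  W₃ := 0
  W₄ := 1
  Wqs := 0
  Wks := 0
  Wqv := 1
  Wkv := 1
  mlp₃ := M₃
  mlp₄ := M₄
  W₅ := Matrix.fromRows 1 0

theorem gramLayer_apply_v (M₁ : MLP (d + d) d) (M₃ : MLP (d + d) 1) (M₄ : MLP (d + d) d)
    (x : PointState n₁ d ρ₁) : ((gramLayer M₁ M₃ M₄).apply x).v = x.v := by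
  funext i
  simp [PSTLayer.apply, PSTLayer.attend, PSTLayer.mix, gramLayer, Matrix.fromCols_mul_fromRows]

theorem gramLayer_apply_s (M₁ : MLP (d + d) d) (M₃ : MLP (d + d) 1) (M₄ : MLP (d + d) d)
    (x : PointState n₁ d ρ₁) (i : Fin n₁) :
    ((gramLayer M₁ M₃ M₄).apply x).s i =
      M₄.eval relu (Fin.append (M₁.eval relu (Fin.append (x.s i) (gram x.v i i)))
        (∑ j, M₃.eval relu (Fin.append 0 (gram x.v i j)) 0 •
          M₁.eval relu (Fin.append (x.s j) (gram x.v j j)))) := by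
  simp [PSTLayer.apply, PSTLayer.attend, PSTLayer.mix, PSTLayer.atten, gramLayer, gram]

/-- One layer of a Point Set Transformer can perform one round of colour refinement. -/
theorem exists_layer_refines (hd : n₁ + n₂ ≤ d) (x : PointState n₁ d ρ₁)
    (y : PointState n₂ d ρ₂) :
    ∃ L : PSTLayer d, (L.apply x).v = x.v ∧ (L.apply y).v = y.v ∧
      (∃ (cx : Fin n₁ → Fin d) (cy : Fin n₂ → Fin d),
        (∀ i, (L.apply x).s i = Pi.single (cx i) 1) ∧
        ∀ j, (L.apply y).s j = Pi.single (cy j) 1) ∧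
      ∀ i j, (L.apply x).s i = (L.apply y).s j →
        (x.s i = y.s j ∧ gram x.v i i = gram y.v j j) ∧
        ∃ π : Fin n₁ ≃ Fin n₂, ∀ m, (x.s m = y.s (π m) ∧ gram x.v m m = gram y.v (π m) (π m)) ∧
          gram x.v i m = gram y.v j (π m) := by
  have hd' : Fintype.card (Fin n₁ ⊕ Fin n₂) ≤ d := by simpa using hd
  obtain ⟨B, hB⟩ := exists_transcendental
  obtain ⟨M₁, c₁, hM₁, hc₁⟩ := exists_mlp_eval_eq_single hd'
    (Sum.elim (fun i => Fin.append (x.s i) (gram x.v i i))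
      (fun j => Fin.append (y.s j) (gram y.v j j)))
  let P : (Fin n₁ × Fin n₁) ⊕ (Fin n₂ × Fin n₂) → Fin (d + d) → ℝ :=
    Sum.elim (fun ij => Fin.append 0 (gram x.v ij.1 ij.2))
      (fun ij => Fin.append 0 (gram y.v ij.1 ij.2))
  obtain ⟨e, he⟩ := exists_code le_rfl P
  obtain ⟨M₃, hM₃⟩ := exists_mlp_eval_eq P (fun t => fun _ : Fin 1 => B ^ (e t).val)
    (fun t t' h => by rw [(he t t').2 h])
  let agg₁ : Fin n₁ → Fin d → ℝ := fun i =>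
    ∑ m, B ^ (e (.inl (i, m))).val • Pi.single (c₁ (.inl m)) 1
  let agg₂ : Fin n₂ → Fin d → ℝ := fun i =>
    ∑ m, B ^ (e (.inr (i, m))).val • Pi.single (c₁ (.inr m)) 1
  obtain ⟨M₄, c₄, hM₄, hc₄⟩ := exists_mlp_eval_eq_single hd'
    (Sum.elim (fun i => Fin.append (Pi.single (c₁ (.inl i)) 1) (agg₁ i))
      (fun j => Fin.append (Pi.single (c₁ (.inr j)) 1) (agg₂ j)))
  have hx : ∀ i, ((gramLayer M₁ M₃ M₄).apply x).s i = Pi.single (c₄ (.inl i)) 1 := by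
    intro i
    rw [gramLayer_apply_s, ← hM₄]
    have h1 := fun i => hM₁ (.inl i)
    have h3 := fun ij => hM₃ (.inl ij)
    simp only [Sum.elim_inl, P] at h1 h3 ⊢
    simp only [h1, fun i m => h3 (i, m), agg₁]
  have hy : ∀ i, ((gramLayer M₁ M₃ M₄).apply y).s i = Pi.single (c₄ (.inr i)) 1 := by
    intro i
    rw [gramLayer_apply_s, ← hM₄]
    have h1 := fun i => hM₁ (.inr i)
    have h3 := fun ij => hM₃ (.inr ij)
    simp only [Sum.elim_inr, P] at h1 h3 ⊢
    simp only [h1, fun i m => h3 (i, m), agg₂]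
  have hsingle : ∀ a b : Fin d, (Pi.single a 1 : Fin d → ℝ) = Pi.single b 1 → a = b := by
    intro a b h
    by_contra hab
    have := congrFun h a
    simp [hab] at this
  refine ⟨gramLayer M₁ M₃ M₄, gramLayer_apply_v .., gramLayer_apply_v .., ⟨_, _, hx, hy⟩,
    fun i j hij => ?_⟩
  rw [hx, hy] at hij
  have h4 := (hc₄ _ _).1 (hsingle _ _ hij)
  simp only [Sum.elim_inl, Sum.elim_inr] at h4
  obtain ⟨h4, h5⟩ := append_eq_append_iff.1 h4
  have hcol : ∀ m m', c₁ (.inl m) = c₁ (.inr m') →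
      x.s m = y.s m' ∧ gram x.v m m = gram y.v m' m' := fun m m' h =>
    append_eq_append_iff.1 ((hc₁ _ _).1 h)
  refine ⟨hcol _ _ (hsingle _ _ h4), ?_⟩
  obtain ⟨π, hπ⟩ := exists_equiv_of_card_filter_eq _ _
    (card_filter_eq_of_sum_pow_eq hB _ _ _ _ h5)
  refine ⟨π, fun m => ⟨hcol _ _ (Prod.ext_iff.1 (hπ m)).1, ?_⟩⟩
  have h6 := (he (.inl (i, m)) (.inr (j, π m))).1 (Fin.ext (Prod.ext_iff.1 (hπ m)).2)
  exact (append_eq_append_iff.1 h6).2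

/-- The comparison of the initial representations of two points. -/
def InitEq (x : PointState n₁ d ρ₁) (y : PointState n₂ d ρ₂) (i : Fin n₁) (j : Fin n₂) : Prop :=
  x.s i = y.s j ∧ gram x.v i i = gram y.v j j

/-- The comparison of inner products. -/
def GramEq (x : PointState n₁ d ρ₁) (y : PointState n₂ d ρ₂) (i m : Fin n₁) (j m' : Fin n₂) :
    Prop :=
  gram x.v i m = gram y.v j m'

/-- `k + 1` layers of a Point Set Transformer can perform `k + 1` rounds of colour refinement. -/
theorem exists_layers_refine (hd : n₁ + n₂ ≤ d) (x : PointState n₁ d ρ₁)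
    (y : PointState n₂ d ρ₂) (k : ℕ) :
    ∃ l : List (PSTLayer d), l.length = k + 1 ∧
      (l.foldl (fun x L => L.apply x) x).v = x.v ∧ (l.foldl (fun x L => L.apply x) y).v = y.v ∧
      (∃ (cx : Fin n₁ → Fin d) (cy : Fin n₂ → Fin d),
        (∀ i, (l.foldl (fun x L => L.apply x) x).s i = Pi.single (cx i) 1) ∧
        ∀ j, (l.foldl (fun x L => L.apply x) y).s j = Pi.single (cy j) 1) ∧
      ∀ i j, (l.foldl (fun x L => L.apply x) x).s i = (l.foldl (fun x L => L.apply x) y).s j →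
        Similar (InitEq x y) (GramEq x y) (k + 1) i j := by
  induction k with
  | zero =>
    obtain ⟨L, h1, h2, h3, h4⟩ := exists_layer_refines hd x y
    exact ⟨[L], rfl, h1, h2, h3, h4⟩
  | succ k ih =>
    obtain ⟨l, hl, hx, hy, -, hs⟩ := ih
    obtain ⟨L, h1, h2, h3, h4⟩ := exists_layer_refines hd
      (l.foldl (fun x L => L.apply x) x) (l.foldl (fun x L => L.apply x) y)
    refine ⟨l ++ [L], by simp [hl], ?_, ?_, ?_, ?_⟩
    · simp only [List.foldl_append, List.foldl_cons, List.foldl_nil]; rw [h1, hx]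
    · simp only [List.foldl_append, List.foldl_cons, List.foldl_nil]; rw [h2, hy]
    · simpa only [List.foldl_append, List.foldl_cons, List.foldl_nil] using h3
    · simp only [List.foldl_append, List.foldl_cons, List.foldl_nil]
      intro i j hij
      obtain ⟨h5, π, hπ⟩ := h4 i j hij
      rw [hx, hy] at hπ
      exact ⟨hs _ _ h5.1, π, fun m => ⟨hs _ _ (hπ m).1.1, (hπ m).2⟩⟩

/-- Sum pooling of the refined points compares all of them. -/
theorem exists_layers_similarSets (hd : n₁ + n₂ ≤ d) (x : PointState n₁ d ρ₁)
    (y : PointState n₂ d ρ₂) {k : ℕ} (hk : 1 ≤ k) :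
    ∃ layers : Fin k → PSTLayer d,
      (Pool.sum.apply ((List.ofFn layers).foldl (fun x L => L.apply x) x).s
          = Pool.sum.apply ((List.ofFn layers).foldl (fun x L => L.apply x) y).s →
        SimilarSets (InitEq x y) (GramEq x y) k) := by
  obtain ⟨k, rfl⟩ := Nat.exists_eq_add_of_le' hk
  obtain ⟨l, hl, -, -, ⟨cx, cy, hx, hy⟩, hs⟩ := exists_layers_refine hd x y k
  obtain ⟨B, hB⟩ := exists_transcendental
  rw [← hl] at hs ⊢
  refine ⟨l.get, fun h => ?_⟩
  rw [List.ofFn_get] at h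
  obtain ⟨π, hπ⟩ := exists_equiv_of_card_filter_eq _ _
    (card_filter_eq_of_sum_pow_eq hB cx (fun _ => 0) cy (fun _ => 0) (by
      have h' : ∑ i, (Pi.single (cx i) 1 : Fin d → ℝ) = ∑ j, Pi.single (cy j) 1 := by
        funext c
        have := congrFun h c
        simpa only [Pool.apply, hx, hy, ← Finset.sum_apply] using this
      simpa using h'))
  refine ⟨π, fun m => hs _ _ ?_⟩
  have hm : cx m = cy (π m) := (Prod.ext_iff.1 (hπ m)).1
  rw [hx, hy, hm]

end Layer

section

theorem pow_apply_eq_sum_eigenvalues {n : ℕ} {A : Matrix (Fin n) (Fin n) ℝ} (hA : A.IsHermitian)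
    (t : ℕ) (i j : Fin n) :
    (A ^ t) i j = ∑ l, hA.eigenvalues l ^ t *
      ((hA.eigenvectorUnitary : Matrix (Fin n) (Fin n) ℝ) i l *
        (hA.eigenvectorUnitary : Matrix (Fin n) (Fin n) ℝ) j l) := by
  conv_lhs => rw [hA.spectral_theorem, ← map_pow, Unitary.conjStarAlgAut_apply]
  rw [Matrix.diagonal_pow, Matrix.mul_apply]
  refine Finset.sum_congr rfl fun l _ => ?_
  rw [Matrix.mul_diagonal, Matrix.star_apply]
  simp
  ring

/-- The eigenvalue function whose channel `c` is the indicator of the eigenvalue `ev c`. -/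
theorem exists_eigenvalueFunction {T : Type*} [Finite T] {d : ℕ} (a : T → ℝ) (ev : Fin d → ℝ) :
    ∃ f : EigenvalueFunction d, ∀ {ρ : Type} [Fintype ρ] (Λ : ρ → ℝ) (l : ρ), (∃ t, Λ l = a t) →
      ∀ c, f.eval Λ l c = if Λ l = ev c then 1 else 0 := by
  obtain ⟨M, hM⟩ := exists_mlp_eval_eq
    (fun t => (Fin.append (fun _ : Fin 1 => a t) (0 : Fin 0 → ℝ) : Fin (1 + 0) → ℝ))
    (fun t c => if a t = ev c then 1 else 0) (fun t t' h => by
      have h1 : a t = a t' := congrFun (append_eq_append_iff.1 h).1 0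
      simp only [h1])
  refine ⟨⟨0, .output 0 0, M⟩, fun Λ l ⟨t, ht⟩ c => ?_⟩
  rw [EigenvalueFunction.eval, ht, Subsingleton.elim (∑ m, _) 0]
  exact congrFun (hM t) c

variable (Z : AdjacencyFunction) {p k : ℕ}

/-- The power sums of the non-zero eigenvalues, grouped by value. -/
theorem pow_succ_apply_eq_sum_gram {n d : ℕ} (G : SimpleGraph (Fin n)) {f : EigenvalueFunction d}
    {ev : Fin d → ℝ}
    (hf : ∀ (l : SpectralIndex Z G) c,
      f.eval (fun m : SpectralIndex Z G => (Z.isHermitian G).eigenvalues m) l c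
        = if (Z.isHermitian G).eigenvalues l = ev c then 1 else 0)
    (hev : ∀ l, ∃ c, ev c = (Z.isHermitian G).eigenvalues l) (t : ℕ) (i j : Fin n) :
    (Z.toMatrix G ^ (t + 1)) i j = ∑ μ : Set.range ev,
      μ.1 ^ (t + 1) * gram (psrd Z f G) i j μ.2.choose := by
  classical
  have hg : ∀ c, gram (psrd Z f G) i j c = ∑ l : SpectralIndex Z G,
      if (Z.isHermitian G).eigenvalues l = ev c then
        ((Z.isHermitian G).eigenvectorUnitary : Matrix (Fin n) (Fin n) ℝ) i l *
        ((Z.isHermitian G).eigenvectorUnitary : Matrix (Fin n) (Fin n) ℝ) j l else 0 := by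
    intro c
    simp only [gram, Matrix.diag_apply, Matrix.mul_apply, Matrix.transpose_apply, psrd,
      Matrix.of_apply, hf]
    refine Finset.sum_congr (by ext; simp) fun l _ => ?_
    split_ifs <;> simp
  simp only [hg, fun μ : Set.range ev => μ.2.choose_spec]
  rw [pow_apply_eq_sum_eigenvalues (Z.isHermitian G)]
  simp only [Finset.mul_sum]
  rw [Finset.sum_comm]
  let F : Fin n → ℝ := fun l => (Z.isHermitian G).eigenvalues l ^ (t + 1) *
    (((Z.isHermitian G).eigenvectorUnitary : Matrix (Fin n) (Fin n) ℝ) i l *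
      ((Z.isHermitian G).eigenvectorUnitary : Matrix (Fin n) (Fin n) ℝ) j l)
  trans ∑ l : SpectralIndex Z G, F l
  · rw [← Finset.sum_subtype (Finset.univ.filter fun l => (Z.isHermitian G).eigenvalues l ≠ 0)
      (by simp) F]
    refine (Finset.sum_filter_of_ne (p := fun l => (Z.isHermitian G).eigenvalues l ≠ 0)
      fun l _ (hl : F l ≠ 0) h0 => hl ?_).symm
    simp [F, h0]
  · refine Finset.sum_congr rfl fun l _ => ?_
    rw [Finset.sum_eq_single ⟨_, hev l⟩ (fun μ _ hμ => ?_) (by simp)]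
    · simp [F]
    · rw [if_neg fun h => hμ (Subtype.ext h.symm), mul_zero]

/-- The comparison of node features and of the diagonal entries of all powers of `Z`. -/
def PowEq (G H : FeaturedGraph p) (i : Fin G.n) (j : Fin H.n) : Prop :=
  G.X i = H.X j ∧ ∀ t, (Z.toMatrix G.graph ^ (t + 1)) i i = (Z.toMatrix H.graph ^ (t + 1)) j j

/-- The comparison of the entries of all powers of `Z`. -/
def PairPowEq (G H : FeaturedGraph p) (i m : Fin G.n) (j m' : Fin H.n) : Prop :=
  ∀ t, (Z.toMatrix G.graph ^ (t + 1)) i m = (Z.toMatrix H.graph ^ (t + 1)) j m'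

/-- Point Set Transformers perform colour refinement with respect to all powers of `Z`. -/
theorem pstWith_of_not_similarSets (hk : 1 ≤ k) (G H : FeaturedGraph p)
    (h : ¬ SimilarSets (PowEq Z G H) (PairPowEq Z G H) k) : pstWith Z k p G H := by
  classical
  let lG := (Z.isHermitian G.graph).eigenvalues
  let lH := (Z.isHermitian H.graph).eigenvalues
  let ev : Fin (p + (G.n + H.n)) → ℝ := Fin.append 0 (Fin.append lG lH)
  have hevG : ∀ l, ∃ c, ev c = lG l := fun l =>
    ⟨Fin.natAdd p (Fin.castAdd H.n l), by simp only [ev, Fin.append_right, Fin.append_left]⟩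
  have hevH : ∀ l, ∃ c, ev c = lH l := fun l =>
    ⟨Fin.natAdd p (Fin.natAdd G.n l), by simp only [ev, Fin.append_right]⟩
  obtain ⟨f, hf⟩ := exists_eigenvalueFunction (Sum.elim lG lH) ev
  let E : Matrix (Fin (p + (G.n + H.n))) (Fin p) ℝ :=
    Matrix.of fun c q => if c = Fin.castAdd (G.n + H.n) q then 1 else 0
  have hE : ∀ (X : Fin p → ℝ) (q : Fin p), (E *ᵥ X) (Fin.castAdd _ q) = X q := by
    intro X q
    simp [E, Matrix.mulVec, dotProduct]
  let x : PointState G.n (p + (G.n + H.n)) (SpectralIndex Z G.graph) :=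
    { s := fun i => E *ᵥ G.X i, v := psrd Z f G.graph }
  let y : PointState H.n (p + (G.n + H.n)) (SpectralIndex Z H.graph) :=
    { s := fun i => E *ᵥ H.X i, v := psrd Z f H.graph }
  obtain ⟨layers, hl⟩ := exists_layers_similarSets (Nat.le_add_left _ p) x y hk
  refine ⟨⟨_, E, f, layers, .sum⟩, fun heq => h ?_⟩
  have hpow : ∀ i m j m', GramEq x y i m j m' → PairPowEq Z G H i m j m' := by
    intro i m j m' hg t
    rw [pow_succ_apply_eq_sum_gram Z G.graph (fun l c => hf _ l ⟨.inl l, rfl⟩ c) hevG,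
      pow_succ_apply_eq_sum_gram Z H.graph (fun l c => hf _ l ⟨.inr l, rfl⟩ c) hevH]
    exact Finset.sum_congr rfl fun μ _ => congrArg _ (congrFun hg _)
  refine (hl ?_).mono (fun i j hij => ⟨?_, hpow i i j j hij.2⟩) hpow
  · exact heq
  · funext q
    rw [← hE (G.X i) q, ← hE (H.X j) q]
    exact congrFun hij.1 _

end

section Invariance

variable {d H : ℕ} {τ τ' : Type} [Fintype τ] [Fintype τ']

theorem MultiHead.apply_congr (M : MultiHead d H) {bias : Fin H → τ → τ → ℝ}
    {bias' : Fin H → τ' → τ' → ℝ} {h : τ → Fin d → ℝ} {h' : τ' → Fin d → ℝ} {i : τ} {j : τ'}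
    (π : τ ≃ τ') (hij : h i = h' j) (hπ : ∀ m, h m = h' (π m))
    (hb : ∀ a m, bias a i m = bias' a j (π m)) : M.apply bias h i = M.apply bias' h' j := by
  have hs : ∀ a m, M.score bias h a i m = M.score bias' h' a j (π m) := by
    intro a m
    simp only [MultiHead.score, hij, hπ m, hb]
  have hw : ∀ a m, M.weight bias h a i m = M.weight bias' h' a j (π m) := by
    intro a m
    simp only [MultiHead.weight, hs]
    rw [π.sum_comp fun l => Real.exp (M.score bias' h' a j l)]
  unfold MultiHead.apply
  congr 1
  funext ac
  rw [← π.sum_comp]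
  exact Finset.sum_congr rfl fun m _ => by rw [hw, hπ]

theorem GraphormerLayer.apply_congr (L : GraphormerLayer d H) (σ : ℝ → ℝ)
    {bias : Fin H → τ → τ → ℝ} {bias' : Fin H → τ' → τ' → ℝ} {h : τ → Fin d → ℝ}
    {h' : τ' → Fin d → ℝ} {i : τ} {j : τ'} (π : τ ≃ τ') (hij : h i = h' j)
    (hπ : ∀ m, h m = h' (π m)) (hb : ∀ a m, bias a i m = bias' a j (π m)) :
    L.apply σ bias h i = L.apply σ bias' h' j := by
  have hM := L.mha.apply_congr (bias := bias) (bias' := bias')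
    (h := fun j => L.ln₁.apply (h j)) (h' := fun j => L.ln₁.apply (h' j)) (i := i) (j := j) π
    (by rw [hij]) (fun m => by rw [hπ]) hb
  simp only [GraphormerLayer.apply, hM, hij]

end Invariance

theorem Pool.apply_congr {n n' d : ℕ} (q : Pool) {h : Fin n → Fin d → ℝ} {h' : Fin n' → Fin d → ℝ}
    (π : Fin n ≃ Fin n') (hπ : ∀ m, h m = h' (π m)) : q.apply h = q.apply h' := by
  obtain rfl : n = n' := by simpa using Fintype.card_congr π
  cases q <;> funext c <;> simp only [Pool.apply, hπ]
  · exact π.sum_comp fun m => h' m c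
  · rw [π.sum_comp fun m => h' m c]
  · exact π.iSup_comp (g := fun m => h' m c)

section Graphormer

variable {p k : ℕ}

/-- The comparison of node features and degrees. -/
def DegEq (G H : FeaturedGraph p) (i : Fin G.n) (j : Fin H.n) : Prop :=
  G.X i = H.X j ∧ deg G.graph i = deg H.graph j

/-- The comparison of shortest path distances. -/
def SpdEq (G H : FeaturedGraph p) (i m : Fin G.n) (j m' : Fin H.n) : Prop :=
  G.graph.edist i m = H.graph.edist j m'

theorem Graphormer.init_congr (P : Graphormer p k) {G H : FeaturedGraph p} {i : Fin G.n}
    {j : Fin H.n} (h : DegEq G H i j) : P.init G i = P.init H j := by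
  rw [Graphormer.init, Graphormer.init, h.1, h.2]

theorem Graphormer.foldl_congr (P : Graphormer p k) {G H : FeaturedGraph p}
    {l : List (GraphormerLayer P.d P.H)} (hk : l.length ≤ k)
    (h : SimilarSets (DegEq G H) (SpdEq G H) k)
    {bG : Fin P.H → Option (Fin G.n) → Option (Fin G.n) → ℝ}
    {bH : Fin P.H → Option (Fin H.n) → Option (Fin H.n) → ℝ}
    {hG : Option (Fin G.n) → Fin P.d → ℝ} {hH : Option (Fin H.n) → Fin P.d → ℝ}
    (hbG : ∀ a i j, bG a (some i) (some j) = P.b a (G.graph.edist i j))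
    (hbH : ∀ a i j, bH a (some i) (some j) = P.b a (H.graph.edist i j))
    (hb : ∀ a x y, bG a none x = bH a none y)
    (hb' : ∀ a x y, bG a x none = bH a y none)
    (h₀ : hG none = hH none) (h₁ : ∀ i, hG (some i) = P.init G i)
    (h₂ : ∀ j, hH (some j) = P.init H j) :
    l.foldl (fun h L => L.apply P.σ bG h) hG none = l.foldl (fun h L => L.apply P.σ bH h) hH none ∧
    ∀ i j, Similar (DegEq G H) (SpdEq G H) l.length i j →
      l.foldl (fun h L => L.apply P.σ bG h) hG (some i) =
        l.foldl (fun h L => L.apply P.σ bH h) hH (some j) := by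
  obtain ⟨π, hπ⟩ := h
  induction l using List.reverseRecOn with
  | nil =>
    refine ⟨h₀, fun i j hij => ?_⟩
    rw [List.foldl_nil, List.foldl_nil, h₁, h₂]
    exact P.init_congr hij
  | append_singleton l L ih =>
    rw [List.length_append, List.length_singleton] at hk ⊢
    obtain ⟨ih₀, ih⟩ := ih (by omega)
    simp only [List.foldl_append, List.foldl_cons, List.foldl_nil]
    refine ⟨L.apply_congr P.σ π.optionCongr ih₀ ?_ fun a x => hb a x _, ?_⟩
    · rintro (_ | m)
      · exact ih₀
      · exact ih m (π m) ((hπ m).of_le (by omega))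
    · rintro i j ⟨hij, π', hπ'⟩
      refine L.apply_congr P.σ π'.optionCongr (ih _ _ hij) ?_ ?_
      · rintro (_ | m)
        · exact ih₀
        · exact ih m (π' m) (hπ' m).1
      · rintro a (_ | m)
        · exact hb' a _ _
        · exact (hbG a i m).trans ((congrArg (P.b a) (hπ' m).2).trans (hbH a j (π' m)).symm)

/-- Graphormers perform at most colour refinement with respect to shortest path distances. -/
theorem Graphormer.out_congr (P : Graphormer p k) {G H : FeaturedGraph p}
    (h : SimilarSets (DegEq G H) (SpdEq G H) k) : P.out G = P.out H := by
  obtain ⟨π, hπ⟩ := h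
  cases hr : P.readout with
  | pool q =>
    have key : ∀ (l : List (GraphormerLayer P.d P.H)) (i : Fin G.n) (j : Fin H.n),
        Similar (DegEq G H) (SpdEq G H) l.length i j →
        l.foldl (fun h L => L.apply P.σ (fun a i j => P.b a (G.graph.edist i j)) h) (P.init G) i =
        l.foldl (fun h L => L.apply P.σ (fun a i j => P.b a (H.graph.edist i j)) h) (P.init H)
          j := by
      intro l
      induction l using List.reverseRecOn with
      | nil => exact fun i j hij => P.init_congr hij
      | append_singleton l L ih =>
        intro i j hij
        rw [List.length_append] at hij
        obtain ⟨hij, π', hπ'⟩ := hij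
        simp only [List.foldl_append, List.foldl_cons, List.foldl_nil]
        exact L.apply_congr P.σ π' (ih i j hij) (fun m => ih _ _ (hπ' m).1)
          (fun a m => congrArg (P.b a) (hπ' m).2)
    simp only [Graphormer.out, hr, Graphormer.encode]
    exact q.apply_congr π fun m => key _ _ _ (by simpa using hπ m)
  | virtualNode =>
    simp only [Graphormer.out, hr, Graphormer.encode]
    exact (P.foldl_congr (by simp) ⟨π, hπ⟩ (fun _ _ _ => rfl) (fun _ _ _ => rfl)
      (fun _ _ _ => rfl) (fun _ x y => by cases x <;> cases y <;> rfl) rfl (fun _ => rfl)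
      (fun _ => rfl)).1

end Graphormer

section Zigzag

variable {ι κ : Type} {R : ι → κ → Prop} {T : ι → ι → κ → κ → Prop}

theorem Similar.zigzag (hR : ∀ a b c e, R a b → R c b → R c e → R a e)
    (hT : ∀ i m j m' i₁ m₁ j₁ m₁', T i m j m' → T i₁ m₁ j m' → T i₁ m₁ j₁ m₁' → T i m j₁ m₁')
    {t : ℕ} {a c : ι} {b e : κ} (h₁ : Similar R T t a b) (h₂ : Similar R T t c b)
    (h₃ : Similar R T t c e) : Similar R T t a e := by
  induction t generalizing a b c e with
  | zero => exact hR _ _ _ _ h₁ h₂ h₃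
  | succ t ih =>
    obtain ⟨h₁, π₁, hπ₁⟩ := h₁
    obtain ⟨h₂, π₂, hπ₂⟩ := h₂
    obtain ⟨h₃, π₃, hπ₃⟩ := h₃
    refine ⟨ih h₁ h₂ h₃, (π₁.trans π₂.symm).trans π₃, fun m => ?_⟩
    have h₄ := hπ₁ m
    have h₅ := hπ₂ (π₂.symm (π₁ m))
    have h₆ := hπ₃ (π₂.symm (π₁ m))
    rw [Equiv.apply_symm_apply] at h₅
    exact ⟨ih h₄.1 h₅.1 h₆.1, hT _ _ _ _ _ _ _ _ h₄.2 h₅.2 h₆.2⟩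

/-- Colour refinement can tell the pairs `(i, i)` from the other ones if it compares them
initially. -/
theorem Similar.and_eq_iff_eq (hR : ∀ a b c e, R a b → R c b → R c e → R a e)
    (hT : ∀ i m j m' i₁ m₁ j₁ m₁', T i m j m' → T i₁ m₁ j m' → T i₁ m₁ j₁ m₁' → T i m j₁ m₁')
    (hRT : ∀ i j, R i j → T i i j j) {t : ℕ} {i : ι} {j : κ} (h : Similar R T t i j) :
    Similar R (fun i m j m' => T i m j m' ∧ (i = m ↔ j = m')) t i j := by
  classical
  induction t generalizing i j with
  | zero => exact h
  | succ t ih =>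
    obtain ⟨h, π, hπ⟩ := h
    refine ⟨ih h, (Equiv.swap i (π.symm j)).trans π, fun m => ?_⟩
    have hi := hπ i
    have hj := hπ (π.symm j)
    rw [Equiv.apply_symm_apply] at hj
    have hT' := hRT i j h.rel
    have hm : Similar R T t m (π (Equiv.swap i (π.symm j) m)) ∧
        T i m j (π (Equiv.swap i (π.symm j) m)) := by
      by_cases h₁ : m = i
      · subst h₁
        rw [Equiv.swap_apply_left, Equiv.apply_symm_apply]
        exact ⟨h, hT'⟩
      · by_cases h₂ : m = π.symm j
        · subst h₂
          rw [Equiv.swap_apply_right]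
          exact ⟨hj.1.zigzag hR hT h hi.1, hT _ _ _ _ _ _ _ _ hj.2 hT' hi.2⟩
        · rw [Equiv.swap_apply_of_ne_of_ne h₁ h₂]
          exact hπ m
    refine ⟨ih hm.1, hm.2, ?_⟩
    rw [Equiv.trans_apply, eq_comm (a := j), ← Equiv.eq_symm_apply, Equiv.swap_apply_eq_iff,
      Equiv.swap_apply_right, eq_comm]

end Zigzag

section Laplacian

variable {n : ℕ} (G : SimpleGraph (Fin n))

theorem laplacian_apply_self (i : Fin n) :
    AdjacencyFunction.laplacian.toMatrix G i i = deg G i := by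
  simp [AdjacencyFunction.toMatrix, degM, adjM]

open scoped Classical in
theorem laplacian_apply_ne {i j : Fin n} (h : i ≠ j) :
    AdjacencyFunction.laplacian.toMatrix G i j = if G.Adj i j then -1 else 0 := by
  simp only [AdjacencyFunction.toMatrix, degM, adjM, Matrix.sub_apply, Matrix.diagonal_apply_ne _ h,
    SimpleGraph.adjMatrix_apply]
  split_ifs <;> simp

theorem laplacian_pow_eq_zero {t : ℕ} {i j : Fin n} (h : (t : ℕ∞) < G.edist i j) :
    (AdjacencyFunction.laplacian.toMatrix G ^ t) i j = 0 := by
  induction t generalizing i j with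
  | zero =>
    rw [pow_zero, Matrix.one_apply_ne]
    rintro rfl
    simp at h
  | succ t ih =>
    rw [pow_succ', Matrix.mul_apply]
    refine Finset.sum_eq_zero fun q _ => ?_
    by_cases hq : G.edist i q ≤ 1
    · rw [ih, mul_zero]
      by_contra! hle
      refine absurd h (not_lt.2 (G.edist_triangle.trans ((add_le_add hq hle).trans ?_)))
      rw [add_comm]; norm_cast
    · rw [SimpleGraph.edist_le_one_iff_adj_or_eq, not_or] at hq
      rw [laplacian_apply_ne G hq.2, if_neg hq.1, zero_mul]

theorem laplacian_pow_pos {t : ℕ} {i j : Fin n} (h : G.edist i j = t) :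
    0 < (-1) ^ t * (AdjacencyFunction.laplacian.toMatrix G ^ t) i j := by
  classical
  induction t generalizing i j with
  | zero =>
    obtain rfl : i = j := by simpa using h
    simp
  | succ t ih =>
    rw [pow_succ' (AdjacencyFunction.laplacian.toMatrix G), Matrix.mul_apply, Finset.mul_sum]
    have hterm : ∀ q, (-1) ^ (t + 1) * (AdjacencyFunction.laplacian.toMatrix G i q *
        (AdjacencyFunction.laplacian.toMatrix G ^ t) q j) =
        if G.Adj i q then (-1) ^ t * (AdjacencyFunction.laplacian.toMatrix G ^ t) q j else 0 := by
      intro q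
      by_cases hq : i = q
      · subst hq
        rw [laplacian_pow_eq_zero G (by rw [h]; norm_cast; omega)]
        simp
      · rw [laplacian_apply_ne G hq]
        split_ifs
        · ring
        · simp
    simp only [hterm]
    have hle : ∀ q, G.Adj i q → (t : ℕ∞) ≤ G.edist q j := by
      intro q hq
      have h1 := G.edist_triangle (u := i) (v := q) (w := j)
      rw [h, SimpleGraph.edist_eq_one_iff_adj.2 hq, add_comm] at h1
      push_cast at h1
      exact (ENat.add_le_add_iff_left ENat.one_ne_top).1 h1
    obtain ⟨w, hw⟩ := SimpleGraph.exists_walk_of_edist_eq_coe h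
    cases w with
    | nil => simp at hw
    | @cons _ q _ hq w =>
      have hw' : w.length = t := by simpa using hw
      refine Finset.sum_pos' (fun q _ => ?_) ⟨q, Finset.mem_univ _, ?_⟩
      · split_ifs with hq
        · rcases (hle q hq).eq_or_lt with h1 | h1
          · exact (ih h1.symm).le
          · rw [laplacian_pow_eq_zero G h1, mul_zero]
        · rfl
      · rw [if_pos hq]
        exact ih (le_antisymm (by rw [← hw']; exact G.edist_le w) (hle q hq))

end Laplacian

theorem edist_le_of_laplacian_pow_eq {n n' : ℕ} {G : SimpleGraph (Fin n)} {H : SimpleGraph (Fin n')}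
    {i m : Fin n} {j m' : Fin n'} (him : i ≠ m)
    (h : ∀ t, (AdjacencyFunction.laplacian.toMatrix G ^ (t + 1)) i m
      = (AdjacencyFunction.laplacian.toMatrix H ^ (t + 1)) j m') :
    H.edist j m' ≤ G.edist i m := by
  by_contra! hlt
  obtain ⟨t, ht⟩ := ENat.ne_top_iff_exists.1 hlt.ne_top
  obtain ⟨t, rfl⟩ : ∃ s, t = s + 1 := Nat.exists_eq_succ_of_ne_zero fun h0 => him <| by
    rw [h0] at ht
    exact SimpleGraph.edist_eq_zero_iff.1 ht.symm
  have h1 := laplacian_pow_pos G ht.symm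
  rw [h, laplacian_pow_eq_zero H (by rwa [ht]), mul_zero] at h1
  exact h1.false

section

variable {p k : ℕ} {G H : FeaturedGraph p}

theorem pairPowEq_zigzag {Z : AdjacencyFunction} {i m i₁ m₁ : Fin G.n} {j m' j₁ m₁' : Fin H.n}
    (h₁ : PairPowEq Z G H i m j m') (h₂ : PairPowEq Z G H i₁ m₁ j m')
    (h₃ : PairPowEq Z G H i₁ m₁ j₁ m₁') : PairPowEq Z G H i m j₁ m₁' :=
  fun t => (h₁ t).trans ((h₂ t).symm.trans (h₃ t))

theorem powEq_zigzag {Z : AdjacencyFunction} {a c : Fin G.n} {b e : Fin H.n}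
    (h₁ : PowEq Z G H a b) (h₂ : PowEq Z G H c b) (h₃ : PowEq Z G H c e) : PowEq Z G H a e :=
  ⟨h₁.1.trans (h₂.1.symm.trans h₃.1), pairPowEq_zigzag h₁.2 h₂.2 h₃.2⟩

theorem similarSets_degEq_of_laplacian
    (h : SimilarSets (PowEq .laplacian G H) (PairPowEq .laplacian G H) k) :
    SimilarSets (DegEq G H) (SpdEq G H) k := by
  obtain ⟨π, hπ⟩ := h
  refine ⟨π, fun m => (Similar.and_eq_iff_eq (R := PowEq .laplacian G H)
    (T := PairPowEq .laplacian G H) (fun _ _ _ _ => powEq_zigzag)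
    (fun _ _ _ _ _ _ _ _ => pairPowEq_zigzag) (fun _ _ h => h.2)
    (hπ m)).mono ?_ ?_⟩
  · intro i j hij
    have := hij.2 0
    rw [zero_add, pow_one, pow_one, laplacian_apply_self, laplacian_apply_self] at this
    exact ⟨hij.1, by exact_mod_cast this⟩
  · rintro i m j m' ⟨hp, he⟩
    by_cases him : i = m
    · rw [SpdEq, him, he.1 him, SimpleGraph.edist_self, SimpleGraph.edist_self]
    · exact le_antisymm (edist_le_of_laplacian_pow_eq (fun h => him (he.2 h)) fun t => (hp t).symm)
        (edist_le_of_laplacian_pow_eq him hp)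

theorem pstWith_laplacian_of_graphormer (hk : 1 ≤ k) (h : graphormer k p G H) :
    pstWith .laplacian k p G H :=
  pstWith_of_not_similarSets .laplacian hk G H fun hs =>
    let ⟨P, hP⟩ := h
    hP (P.out_congr (similarSets_degEq_of_laplacian hs))

section GPS

/-- The comparison of node features and return probabilities of the random walk. -/
def ReturnEq (G H : FeaturedGraph p) (i : Fin G.n) (j : Fin H.n) : Prop :=
  G.X i = H.X j ∧ ∀ t, (walkM G.graph ^ (t + 1)) i i = (walkM H.graph ^ (t + 1)) j j

/-- The comparison of adjacency. -/
def AdjEq (G H : FeaturedGraph p) (i m : Fin G.n) (j m' : Fin H.n) : Prop :=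
  G.graph.Adj i m ↔ H.graph.Adj j m'

open scoped Classical in
theorem GPSLayer.apply_congr {d H n n' : ℕ} (L : GPSLayer d H) (σ : ℝ → ℝ)
    {G : SimpleGraph (Fin n)} {G' : SimpleGraph (Fin n')} {h : Fin n → Fin d → ℝ}
    {h' : Fin n' → Fin d → ℝ} {i : Fin n} {j : Fin n'} (π : Fin n ≃ Fin n') (hij : h i = h' j)
    (hπ : ∀ m, h m = h' (π m)) (hA : ∀ m, G.Adj i m ↔ G'.Adj j (π m)) :
    L.apply σ G h i = L.apply σ G' h' j := by
  have hN : (G.neighborFinset i).val.map h = (G'.neighborFinset j).val.map h' := by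
    have h1 : G'.neighborFinset j = (G.neighborFinset i).map π.toEmbedding := by
      ext m
      simp [Finset.mem_map_equiv, hA]
    rw [h1, Finset.map_val, Multiset.map_map]
    exact Multiset.map_congr rfl fun m _ => hπ m
  have hM : L.mha.apply (fun _ _ _ => 0) h i = L.mha.apply (fun _ _ _ => 0) h' j :=
    L.mha.apply_congr π hij hπ fun _ _ => rfl
  simp only [GPSLayer.apply, hM, hij]
  rw [hN]

/-- GPS networks perform at most colour refinement with respect to adjacency. -/
theorem GPS.out_congr (P : GPS p k) (h : SimilarSets (ReturnEq G H) (AdjEq G H) k) :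
    P.out G = P.out H := by
  obtain ⟨π, hπ⟩ := h
  have key : ∀ (l : List (GPSLayer P.d P.H)) (i : Fin G.n) (j : Fin H.n),
      Similar (ReturnEq G H) (AdjEq G H) l.length i j →
      l.foldl (fun h L => L.apply P.σ G.graph h)
        (fun i => P.encoder.eval P.σ (Fin.append (G.X i) (rwse G.graph P.m i))) i =
      l.foldl (fun h L => L.apply P.σ H.graph h)
        (fun i => P.encoder.eval P.σ (Fin.append (H.X i) (rwse H.graph P.m i))) j := by
    intro l
    induction l using List.reverseRecOn with
    | nil =>
      intro i j hij
      have hr : rwse G.graph P.m i = rwse H.graph P.m j := funext fun t => hij.2 t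
      simp only [List.foldl_nil, hr, hij.1]
    | append_singleton l L ih =>
      intro i j hij
      rw [List.length_append] at hij
      obtain ⟨hij, π', hπ'⟩ := hij
      simp only [List.foldl_append, List.foldl_cons, List.foldl_nil]
      exact L.apply_congr P.σ π' (ih i j hij) (fun m => ih _ _ (hπ' m).1) fun m => (hπ' m).2
  exact P.pool.apply_congr π fun m => key _ _ _ (by simpa using hπ m)

open scoped Classical in
theorem normAdjM_ne_zero_iff {n : ℕ} {G : SimpleGraph (Fin n)} {i j : Fin n} :
    normAdjM G i j ≠ 0 ↔ G.Adj i j := by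
  by_cases h : G.Adj i j
  · have hi : 0 < deg G i := (G.degree_pos_iff_exists_adj i).2 ⟨j, h⟩
    have hj : 0 < deg G j := (G.degree_pos_iff_exists_adj j).2 ⟨i, h.symm⟩
    have : √(deg G i : ℝ) ≠ 0 := by positivity
    have : √(deg G j : ℝ) ≠ 0 := by positivity
    simp_all [normAdjM, adjM]
  · simp [normAdjM, adjM, h]

/-- `D^{-1} A` and `D^{-1/2} A D^{-1/2}` are conjugate by `D^{1/2}`. -/
theorem sqrt_mul_walkM_pow {n : ℕ} (G : SimpleGraph (Fin n)) (t : ℕ) (i j : Fin n) :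
    √(deg G i) * (walkM G ^ t) i j = (normAdjM G ^ t) i j * √(deg G j) := by
  have h : Matrix.diagonal (fun i => √(deg G i : ℝ)) * walkM G
      = normAdjM G * Matrix.diagonal fun i => √(deg G i : ℝ) := by
    classical
    ext i j
    rw [Matrix.diagonal_mul, Matrix.mul_diagonal]
    by_cases hA : G.Adj i j
    · have hi : 0 < deg G i := (G.degree_pos_iff_exists_adj i).2 ⟨j, hA⟩
      have hj : 0 < deg G j := (G.degree_pos_iff_exists_adj j).2 ⟨i, hA.symm⟩
      have h2 : √(deg G j : ℝ) ≠ 0 := by positivity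
      simp only [walkM, normAdjM, Matrix.of_apply]
      rw [div_mul_eq_mul_div, mul_div_mul_right _ _ h2, mul_div_left_comm, Real.sqrt_div_self',
        mul_one_div]
    · simp [walkM, normAdjM, adjM, hA]
  have h' : ∀ t, Matrix.diagonal (fun i => √(deg G i : ℝ)) * walkM G ^ t
      = normAdjM G ^ t * Matrix.diagonal fun i => √(deg G i : ℝ) := by
    intro t
    induction t with
    | zero => simp
    | succ t ih => rw [pow_succ, ← mul_assoc, ih, mul_assoc, h, ← mul_assoc, ← pow_succ]
  have := congrFun (congrFun (h' t) i) j
  rwa [Matrix.diagonal_mul, Matrix.mul_diagonal] at this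

theorem walkM_pow_apply_self {n : ℕ} (G : SimpleGraph (Fin n)) (t : ℕ) (i : Fin n) :
    (walkM G ^ (t + 1)) i i = (normAdjM G ^ (t + 1)) i i := by
  by_cases h : deg G i = 0
  · rw [pow_succ', pow_succ', Matrix.mul_apply, Matrix.mul_apply]
    simp [walkM, normAdjM, h]
  · have h1 : √(deg G i : ℝ) ≠ 0 := by positivity
    exact mul_left_cancel₀ h1 ((sqrt_mul_walkM_pow G (t + 1) i i).trans (mul_comm _ _))

theorem pstWith_normalizedAdjacency_of_gps (hk : 1 ≤ k) (h : gps k p G H) :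
    pstWith .normalizedAdjacency k p G H :=
  pstWith_of_not_similarSets .normalizedAdjacency hk G H fun hs => by
    obtain ⟨P, hP⟩ := h
    refine hP (P.out_congr (hs.mono (fun i j hij => ⟨hij.1, fun t => ?_⟩) fun i m j m' h => ?_))
    · have h0 := h 0
      rw [zero_add, pow_one, pow_one] at h0
      rw [AdjEq, ← normAdjM_ne_zero_iff, ← normAdjM_ne_zero_iff]
      exact not_congr (Eq.congr_left h0)
    · rw [walkM_pow_apply_self, walkM_pow_apply_self]
      exact hij.2 t

end GPS

end

/-- The circulant graph on `Fin n` with the symmetric set of differences `S`. -/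
def circulant (n : ℕ) [NeZero n] (S : Finset (Fin n)) (h₀ : 0 ∉ S) (hS : ∀ a ∈ S, -a ∈ S) :
    SimpleGraph (Fin n) where
  Adj i j := i - j ∈ S
  symm := ⟨fun i j h => by simpa using hS _ h⟩
  loopless := ⟨fun i h => h₀ (by simpa using h)⟩

instance (n : ℕ) [NeZero n] (S : Finset (Fin n)) (h₀ : 0 ∉ S) (hS : ∀ a ∈ S, -a ∈ S) :
    DecidableRel (circulant n S h₀ hS).Adj :=
  fun i j => inferInstanceAs (Decidable (i - j ∈ S))

theorem deg_eq_degree {n : ℕ} (G : SimpleGraph (Fin n)) [DecidableRel G.Adj] (i : Fin n) :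
    deg G i = G.degree i := by
  unfold deg
  congr!

theorem adjM_eq_map {n : ℕ} (G : SimpleGraph (Fin n)) [DecidableRel G.Adj] :
    adjM G = (G.adjMatrix ℤ).map (Int.castRingHom ℝ) := by
  ext i j
  simp only [adjM, SimpleGraph.adjMatrix_apply, Matrix.map_apply]
  split_ifs <;> simp

theorem edist_of_diam_le_two {n : ℕ} (G : SimpleGraph (Fin n)) [DecidableRel G.Adj]
    (hG : ∀ i j, i ≠ j → ¬ G.Adj i j → ∃ q, G.Adj i q ∧ G.Adj q j) (i j : Fin n) :
    G.edist i j = if i = j then 0 else if G.Adj i j then 1 else 2 := by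
  split_ifs with h1 h2
  · simpa using h1
  · exact SimpleGraph.edist_eq_one_iff_adj.2 h2
  · obtain ⟨q, hq, hq'⟩ := hG i j h1 h2
    refine le_antisymm (G.edist_le (.cons hq (.cons hq' .nil))) ?_
    by_contra! hlt
    have : G.edist i j ≤ 1 := Order.le_of_lt_add_one (by rwa [one_add_one_eq_two])
    rw [SimpleGraph.edist_le_one_iff_adj_or_eq] at this
    tauto

/-- A graph all of whose nodes have the feature `1` if they belong to `S`, and `0` otherwise. -/
abbrev marked {n : ℕ} (G : SimpleGraph (Fin n)) (S : Finset (Fin n)) : FeaturedGraph 1 :=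
  ⟨n, G, fun i _ => if i ∈ S then 1 else 0⟩

theorem marked_X_eq_iff {n : ℕ} {G : SimpleGraph (Fin n)} {S T : Finset (Fin n)} {i j : Fin n} :
    (marked G S).X i = (marked G T).X j ↔ (i ∈ S ↔ j ∈ T) := by
  constructor
  · intro h
    have := congrFun h 0
    by_cases h1 : i ∈ S <;> by_cases h2 : j ∈ T <;> simp_all
  · intro h
    funext c
    simp [h]

/-- The complete bipartite graph with three nodes on each side. -/
abbrev bipartiteGraph : SimpleGraph (Fin 6) := circulant 6 {1, 3, 5} (by decide) (by decide)

/-- The triangular prism. -/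
abbrev prismGraph : SimpleGraph (Fin 6) := circulant 6 {2, 3, 4} (by decide) (by decide)

theorem exists_equiv_edist_bipartite_prism (i j : Fin 6) : ∃ π : Fin 6 ≃ Fin 6, ∀ m,
    bipartiteGraph.edist i m = prismGraph.edist j (π m) := by
  have hcard : ∀ (i j : Fin 6) (c : Bool × Bool),
      (Finset.univ.filter fun m : Fin 6 =>
        (decide (i = m), decide (bipartiteGraph.Adj i m)) = c).card =
      (Finset.univ.filter fun m : Fin 6 =>
        (decide (j = m), decide (prismGraph.Adj j m)) = c).card := by decide +kernel
  obtain ⟨π, hπ⟩ := exists_equiv_of_card_filter_eq _ _ (hcard i j)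
  refine ⟨π, fun m => ?_⟩
  rw [edist_of_diam_le_two bipartiteGraph (by decide +kernel),
    edist_of_diam_le_two prismGraph (by decide +kernel)]
  have h1 := hπ m
  simp only [Prod.mk.injEq, decide_eq_decide] at h1
  exact if_congr h1.1 rfl (if_congr h1.2 rfl rfl)

theorem deg_bipartite_eq_prism (i j : Fin 6) : deg bipartiteGraph i = deg prismGraph j := by
  rw [deg_eq_degree, deg_eq_degree]
  revert i j
  decide +kernel

theorem not_graphormer_bipartite_prism (k : ℕ) :
    ¬ graphormer k 1 (marked bipartiteGraph ∅) (marked prismGraph ∅) := by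
  rintro ⟨P, hP⟩
  refine hP (P.out_congr ?_)
  have hS : ∀ (t : ℕ) (i j : Fin 6), Similar (DegEq (marked bipartiteGraph ∅) (marked prismGraph ∅))
      (SpdEq (marked bipartiteGraph ∅) (marked prismGraph ∅)) t i j := by
    intro t
    induction t with
    | zero => exact fun i j => ⟨rfl, deg_bipartite_eq_prism i j⟩
    | succ t ih =>
      exact fun i j => ⟨ih i j, let ⟨π, hπ⟩ := exists_equiv_edist_bipartite_prism i j
        ⟨π, fun m => ⟨ih _ _, hπ m⟩⟩⟩
  exact ⟨Equiv.refl (Fin 6), fun m => hS k m m⟩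

theorem laplacian_pow_apply {n : ℕ} (G : SimpleGraph (Fin n)) [DecidableRel G.Adj] (t : ℕ)
    (i j : Fin n) : (AdjacencyFunction.laplacian.toMatrix G ^ t) i j
      = ((((Matrix.diagonal fun i => (G.degree i : ℤ)) - G.adjMatrix ℤ) ^ t) i j : ℤ) := by
  have h : AdjacencyFunction.laplacian.toMatrix G
      = ((Matrix.diagonal fun i => (G.degree i : ℤ)) - G.adjMatrix ℤ).map
        (Int.castRingHom ℝ) := by
    rw [AdjacencyFunction.toMatrix, degM, adjM_eq_map]
    ext i j
    simp [deg_eq_degree, Matrix.diagonal_apply]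
  rw [h, ← Matrix.map_pow, Matrix.map_apply, eq_intCast]

theorem pstWith_bipartite_prism {k : ℕ} (hk : 1 ≤ k) :
    pstWith .laplacian k 1 (marked bipartiteGraph ∅) (marked prismGraph ∅) := by
  refine pstWith_of_not_similarSets _ hk _ _ fun ⟨π, hπ⟩ => ?_
  have h := (hπ (0 : Fin 6)).rel.2 2
  rw [laplacian_pow_apply bipartiteGraph, laplacian_pow_apply prismGraph, Int.cast_inj] at h
  revert h
  generalize π (0 : Fin 6) = j
  revert j
  decide +kernel

/-- The square of a cycle with ten nodes. -/
abbrev cycleSquare : SimpleGraph (Fin 10) := circulant 10 {1, 2, 8, 9} (by decide) (by decide)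

theorem deg_cycleSquare (i : Fin 10) : deg cycleSquare i = 4 := by
  rw [deg_eq_degree]
  revert i
  decide +kernel

theorem pow_apply_self_of_submatrix_eq {n : ℕ} {A : Matrix (Fin n) (Fin n) ℝ} (e : Fin n ≃ Fin n)
    (hA : A.submatrix e e = A) (t : ℕ) (i : Fin n) : (A ^ t) (e i) (e i) = (A ^ t) i i := by
  have h : (A ^ t).submatrix e e = A ^ t := by
    induction t with
    | zero => simp
    | succ t ih => rw [pow_succ, ← Matrix.submatrix_mul_equiv _ _ e e e, ih, hA]
  exact congrFun (congrFun h i) i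

theorem walkM_cycleSquare_pow (t : ℕ) (i j : Fin 10) :
    (walkM cycleSquare ^ t) i i = (walkM cycleSquare ^ t) j j := by
  have h := pow_apply_self_of_submatrix_eq (A := walkM cycleSquare) (Equiv.addRight (i - j)) (by
      ext a b
      have hA : cycleSquare.Adj (a + (i - j)) (b + (i - j)) ↔ cycleSquare.Adj a b := by
        simp only [circulant, add_sub_add_right_eq_sub]
      simp only [Matrix.submatrix_apply, walkM, Matrix.of_apply, deg_cycleSquare, adjM_eq_map,
        Matrix.map_apply, SimpleGraph.adjMatrix_apply, Equiv.coe_addRight, hA]) t j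
  rw [← h]
  simp

theorem not_gps_cycleSquare (k : ℕ) :
    ¬ gps k 1 (marked cycleSquare {0, 4, 5, 9}) (marked cycleSquare {0, 3, 5, 8}) := by
  rintro ⟨P, hP⟩
  refine hP (P.out_congr ?_)
  have hcard : ∀ i j : Fin 10, (i ∈ ({0, 4, 5, 9} : Finset (Fin 10)) ↔
      j ∈ ({0, 3, 5, 8} : Finset (Fin 10))) → ∀ c : Bool × Bool,
      (Finset.univ.filter fun m : Fin 10 => (decide (m ∈ ({0, 4, 5, 9} : Finset (Fin 10))),
        decide (cycleSquare.Adj i m)) = c).card =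
      (Finset.univ.filter fun m : Fin 10 => (decide (m ∈ ({0, 3, 5, 8} : Finset (Fin 10))),
        decide (cycleSquare.Adj j m)) = c).card := by decide +kernel
  have hS : ∀ (t : ℕ) (i j : Fin 10), (i ∈ ({0, 4, 5, 9} : Finset (Fin 10)) ↔
      j ∈ ({0, 3, 5, 8} : Finset (Fin 10))) →
      Similar (ReturnEq (marked cycleSquare {0, 4, 5, 9}) (marked cycleSquare {0, 3, 5, 8}))
        (AdjEq (marked cycleSquare {0, 4, 5, 9}) (marked cycleSquare {0, 3, 5, 8})) t i j := by
    intro t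
    induction t with
    | zero => exact fun i j h => ⟨marked_X_eq_iff.2 h, fun t => walkM_cycleSquare_pow _ _ _⟩
    | succ t ih =>
      intro i j h
      obtain ⟨π, hπ⟩ := exists_equiv_of_card_filter_eq _ _ (hcard i j h)
      refine ⟨ih i j h, π, fun m => ?_⟩
      have h1 := hπ m
      simp only [Prod.mk.injEq, decide_eq_decide] at h1
      exact ⟨ih _ _ h1.1, h1.2⟩
  obtain ⟨π, hπ⟩ := exists_equiv_of_card_filter_eq
    (fun m : Fin 10 => decide (m ∈ ({0, 4, 5, 9} : Finset (Fin 10))))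
    (fun m : Fin 10 => decide (m ∈ ({0, 3, 5, 8} : Finset (Fin 10)))) (by decide)
  exact ⟨π, fun m => hS k _ _ (decide_eq_decide.1 (hπ m))⟩

theorem normAdjM_cycleSquare_pow (t : ℕ) (i j : Fin 10) :
    (normAdjM cycleSquare ^ t) i j
      = (4 : ℝ)⁻¹ ^ t * ((cycleSquare.adjMatrix ℤ ^ t) i j : ℤ) := by
  have h : normAdjM cycleSquare
      = (4 : ℝ)⁻¹ • (cycleSquare.adjMatrix ℤ).map (Int.castRingHom ℝ) := by
    rw [← adjM_eq_map]
    ext i j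
    simp only [normAdjM, Matrix.of_apply, deg_cycleSquare, Matrix.smul_apply, smul_eq_mul]
    rw [Real.mul_self_sqrt (by norm_num), div_eq_inv_mul]
    norm_num
  rw [h, smul_pow, ← Matrix.map_pow, Matrix.smul_apply, Matrix.map_apply, eq_intCast, smul_eq_mul]

theorem pstWith_cycleSquare {k : ℕ} (hk : 1 ≤ k) :
    pstWith .normalizedAdjacency k 1 (marked cycleSquare {0, 4, 5, 9})
      (marked cycleSquare {0, 3, 5, 8}) := by
  refine pstWith_of_not_similarSets _ hk _ _ fun ⟨π, hπ⟩ => ?_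
  obtain ⟨h0, π', hπ'⟩ := (hπ (0 : Fin 10)).of_le hk
  obtain ⟨h9, hp⟩ := hπ' (9 : Fin 10)
  have h0 := marked_X_eq_iff.1 h0.1
  have h9 := marked_X_eq_iff.1 h9.1
  have hA : ∀ t, (cycleSquare.adjMatrix ℤ ^ (t + 1)) 0 9
      = (cycleSquare.adjMatrix ℤ ^ (t + 1)) (π (0 : Fin 10)) (π' (9 : Fin 10)) := by
    intro t
    have h : (normAdjM cycleSquare ^ (t + 1)) 0 9
      = (normAdjM cycleSquare ^ (t + 1)) (π (0 : Fin 10)) (π' (9 : Fin 10)) := hp t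
    rw [normAdjM_cycleSquare_pow, normAdjM_cycleSquare_pow] at h
    exact_mod_cast mul_left_cancel₀ (by positivity) h
  have key : ∀ ab : Fin 10 × Fin 10, ((0 : Fin 10) ∈ ({0, 4, 5, 9} : Finset (Fin 10)) ↔
      ab.1 ∈ ({0, 3, 5, 8} : Finset (Fin 10))) →
      ((9 : Fin 10) ∈ ({0, 4, 5, 9} : Finset (Fin 10)) ↔
      ab.2 ∈ ({0, 3, 5, 8} : Finset (Fin 10))) →
      (cycleSquare.adjMatrix ℤ ^ (0 + 1)) 0 9 = (cycleSquare.adjMatrix ℤ ^ (0 + 1)) ab.1 ab.2 →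
      (cycleSquare.adjMatrix ℤ ^ (1 + 1)) 0 9 ≠ (cycleSquare.adjMatrix ℤ ^ (1 + 1)) ab.1 ab.2 := by
    decide +kernel
  exact key (_, _) h0 h9 (hA 0) (hA 1)

theorem strictlyMoreExpressive_laplacian_graphormer {k : ℕ} (hk : 1 ≤ k) :
    StrictlyMoreExpressive (pstWith .laplacian k) (graphormer k) :=
  ⟨fun _ _ _ => pstWith_laplacian_of_graphormer hk, 1, marked bipartiteGraph ∅, marked prismGraph ∅,
    pstWith_bipartite_prism hk, not_graphormer_bipartite_prism k⟩

theorem strictlyMoreExpressive_normalizedAdjacency_gps {k : ℕ} (hk : 1 ≤ k) :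
    StrictlyMoreExpressive (pstWith .normalizedAdjacency k) (gps k) :=
  ⟨fun _ _ _ => pstWith_normalizedAdjacency_of_gps hk, 1, _, _,
    pstWith_cycleSquare hk, not_gps_cycleSquare k⟩

theorem StrictlyMoreExpressive.pst {Z : AdjacencyFunction} {k : ℕ} {ℬ : Algorithm}
    (h : StrictlyMoreExpressive (pstWith Z k) ℬ) : StrictlyMoreExpressive (pst k) ℬ :=
  ⟨fun p G H hGH => ⟨Z, h.1 p G H hGH⟩, let ⟨p, G, H, hGH, hn⟩ := h.2; ⟨p, G, H, ⟨Z, hGH⟩, hn⟩⟩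

end PointSet

theorem mainTheorem11 (k : ℕ) (hk : 1 ≤ k) :
    (PointSet.StrictlyMoreExpressive (PointSet.pst k) (PointSet.graphormer k) ∧
      PointSet.StrictlyMoreExpressive (PointSet.pst k) (PointSet.gps k)) ∧
    PointSet.StrictlyMoreExpressive
      (PointSet.pstWith PointSet.AdjacencyFunction.laplacian k) (PointSet.graphormer k) ∧
    PointSet.StrictlyMoreExpressive
      (PointSet.pstWith PointSet.AdjacencyFunction.normalizedAdjacency k) (PointSet.gps k) := by
  have h₁ := PointSet.strictlyMoreExpressive_laplacian_graphormer hk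
  have h₂ := PointSet.strictlyMoreExpressive_normalizedAdjacency_gps hk
  exact ⟨⟨h₁.pst, h₂.pst⟩, h₁, h₂⟩
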